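/- **Setting.** Let $\mathcal F$ be a finite set of files and $\mathcal P$ a finite nonempty set of positive power levels. A small base station works in broadcast rounds $\theta=1,2,\dots$. In round $\theta$ its cache $\mathcal L_\theta\subseteq\mathcal F$ is nonempty (put $\mathcal L_0=\varnothing$), and it plays an action $i_\theta=(f,p)\in\mathcal I_\theta=\mathcal L_\theta\times\mathcal P$: it sends packets of $f$ with power $p$, counting the Acks, until the number $K$ of file recoveries equals the number of requests for $f$ in round $\theta-1$, or the maximal number $D_f\ge 1$ of packets has been sent. If $T$ packets were sent, the utility is $g_\theta(i_\theta)=K/(pT)$; $g_\theta(i)$ denotes the utility action $i$ would give in round $\theta$. Let $(\mathcal H_\theta)_{\theta\ge0}$ be a filtration on a probability space such that $\mathcal L_{\theta+1}$ is $\mathcal H_\theta$-measurable and each $g_\theta(i)$ is $\mathcal H_\theta$-measurable. Let $b,\Delta>0$ and put $\mu_\theta(i)=\mathbb E[g_\theta(i)\mid\mathcal H_{\theta-1}]$. Assume that utilities are at most $b$, and that almost surely, for all $\theta\ge1$: (i) if $\mathcal L_{\theta+1}=\mathcal L_\theta$ then $\mu_{\theta+1}=\mu_\theta$ on $\mathcal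 I_\theta$ (the expected utilities of the available actions do not vary as long as the cache does not change); (ii) every $i\in\mathcal I_\theta$ has $\mu_\theta(i)=\max_{\mathcal I_\theta}\mu_\theta$ or $\mu_\theta(i)\le\max_{\mathcal I_\theta}\mu_\theta-\Delta$. **Policy (adapted UCB with mortal arms).** Each action $i$ has a play count $V_i$ and an average $\bar g_i$; an action that is new has $V_i=0$. At the beginning of a round in which the cache has changed, the actions of the files that were and still are cached keep $\bar g_i$ and get $V_i=1$ (those not yet played since their file entered the cache keep $V_i=0$); the actions of files that newly enter the cache are new. In round $\theta+1$, if some $i\in\mathcal I_{\theta+1}$ has $V_i=0$, one such action is played; otherwise an action of $\mathcal I_{\theta+1}$ with the largest index $$\nu_{i,\theta}=\bar g_i+\beta\sqrt{\frac{\zeta\log\theta}{V_i}}$$ is played. After a play of $i$ with utility $g$, $\bar g_i$ is replaced by $(V_i\bar g_i+g)/(V_i+1)$ and $V_i$ by $V_i+1$. Ties, and the order in which new actions are played, are resolved arbitrarily, provided that the action of round $\theta+1$ is $\mathcal H_\theta$-measurable. **Proposition.** Let $\beta>0$ and $\beta^2\zeta\ge 2b^2$. There is a constant $C$, depending only on $\mathcal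 F,\mathcal P,b,\Delta,\beta,\zeta$, such that in every such setting and for all $\theta\ge2$ the expected regret of the policy satisfies $$R_\theta:=\mathbb E\Big[\sum_{s=1}^{\theta}\Big(\max_{i\in\mathcal I_s}\mu_s(i)-g_s(i_s)\Big)\Big]\;\le\; C\,\mathbb E[B_\theta]\,\log\theta ,$$ where $B_\theta$ is the number of rounds $s\in\{1,\dots,\theta\}$ in which a new file enters the cache, i.e. $\mathcal L_s\setminus\mathcal L_{s-1}\ne\varnothing$ (round $1$ is counted). If the caches are deterministic, then $R_\theta\le C\,B_\theta\log\theta$. -/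

import Mathlib

open MeasureTheory

noncomputable section

namespace FemtoCache

/-- Number of file recoveries after `n` transmission trials of a broadcast round, where `a τ` is the
number of Ack signals received in trial `τ + 1`. -/
def recoveries (a : ℕ → ℕ) (n : ℕ) : ℕ := ∑ τ ∈ Finset.range n, a τ

/-- Length of a broadcast round: packets are sent, at least one, until the number of recoveries equals
the number `q` of interested users or `D` packets have been sent. -/
def roundLength (D q : ℕ) (a : ℕ → ℕ) : ℕ :=
  sInf {n : ℕ | 1 ≤ n ∧ (recoveries a n = q ∨ n = D)}

/-- Energy spent in a broadcast round: transmit power times the length of the round. -/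
def energy (p : ℝ) (D q : ℕ) (a : ℕ → ℕ) : ℝ := p * (roundLength D q a : ℝ)

/-- Utility of a broadcast round: number of successful file recoveries per unit of energy. -/
def utility (p : ℝ) (D q : ℕ) (a : ℕ → ℕ) : ℝ :=
  (recoveries a (roundLength D q a) : ℝ) / energy p D q a

/-- A small base station on a sample space `Ω`. Broadcast rounds are numbered `1, 2, …`; index `0` stands
for the time before the first round, when nothing is cached and initial requests are observed. -/
structure BaseStation (File Power Ω : Type*) where
  /-- transmit power of each power level -/
  level : Power → ℝ
  level_pos : ∀ p, 0 < level p
  /-- maximal number of packets sent when broadcasting a file -/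
  deadline : File → ℕ
  deadline_pos : ∀ f, 0 < deadline f
  /-- `cache t` is the set of files stored during round `t` -/
  cache : ℕ → Ω → Finset File
  cache_zero : ∀ ω, cache 0 ω = ∅
  cache_nonempty : ∀ t ω, (cache (t + 1) ω).Nonempty
  /-- `requests t ω f` is the number of requests for `f` during round `t` -/
  requests : ℕ → Ω → File → ℕ
  /-- `acks t ω i τ` is the number of Ack signals received in trial `τ + 1` of round `t` if the
  (file, power) pair `i` is used in that round -/
  acks : ℕ → Ω → File × Power → ℕ → ℕ

/-- What the policy remembers about each action: the play count (`0` while the action is new and has not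
been played yet) and the average reward. -/
structure Memory (File Power : Type*) where
  count : File × Power → ℕ
  avg : File × Power → ℝ

section
variable {File Power Ω : Type*}

namespace BaseStation

/-- Utility of action `i` in round `t`; the users interested in a file are those that requested it in
round `t - 1`. -/
def gain (S : BaseStation File Power Ω) (t : ℕ) (ω : Ω) (i : File × Power) : ℝ :=
  utility (S.level i.2) (S.deadline i.1) (S.requests (t - 1) ω i.1) (S.acks t ω i)

/-- The actions available in round `t`: cached file, arbitrary power level. -/
def actions [Fintype Power] (S : BaseStation File Power Ω) (t : ℕ) (ω : Ω) : Finset (File × Power) :=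
  S.cache t ω ×ˢ Finset.univ

/-- Number of rounds among `1, …, θ` in which some file enters the cache that was not in the cache in
the previous round (the first filling of the cache in round `1` is included). -/
def newFileCount [DecidableEq File] (S : BaseStation File Power Ω) (θ : ℕ) (ω : Ω) : ℕ :=
  ((Finset.Icc 1 θ).filter (fun t => (S.cache t ω \ S.cache (t - 1) ω).Nonempty)).card

end BaseStation

namespace Memory

/-- Adaptation of the memory to the cache at the beginning of a round. If the cache has changed, then the
actions of files that were and still are cached keep their averages and have their counts set to `1`
(an action still waiting for its first play keeps waiting); all other actions are forgotten. -/
def refresh [DecidableEq File] (old new : Finset File) (s : Memory File Power) : Memory File Power :=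
  if old = new then s
  else
    { count := fun i => if i.1 ∈ old ∧ i.1 ∈ new then min (s.count i) 1 else 0
      avg := fun i => if i.1 ∈ old ∧ i.1 ∈ new then s.avg i else 0 }

/-- Update after action `i` has been played with reward `x`. -/
def record [DecidableEq File] [DecidableEq Power] (s : Memory File Power) (i : File × Power) (x : ℝ) :
    Memory File Power where
  count := Function.update s.count i (s.count i + 1)
  avg := Function.update s.avg i (((s.count i : ℝ) * s.avg i + x) / ((s.count i : ℝ) + 1))

/-- The UCB index of action `i` after round `t`. -/
def index (β ζ : ℝ) (t : ℕ) (s : Memory File Power) (i : File × Power) : ℝ :=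
  s.avg i + β * Real.sqrt (ζ * Real.log (t : ℝ) / (s.count i : ℝ))

/-- Action `i` may be chosen in round `t + 1` from the set `I`: as long as there are new actions that
have not been played, one of them is played; otherwise an action of largest index is played. -/
def Selects (β ζ : ℝ) (t : ℕ) (s : Memory File Power) (I : Finset (File × Power))
    (i : File × Power) : Prop :=
  i ∈ I ∧ ((∃ j ∈ I, s.count j = 0) → s.count i = 0) ∧
    ((∀ j ∈ I, s.count j ≠ 0) → ∀ j ∈ I, index β ζ t s j ≤ index β ζ t s i)

end Memory

namespace BaseStation

/-- The memory at the end of round `t` when action `act t` is played in round `t`. -/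
def memory [DecidableEq File] [DecidableEq Power] (S : BaseStation File Power Ω)
    (act : ℕ → Ω → File × Power) : ℕ → Ω → Memory File Power
  | 0, _ => { count := fun _ => 0, avg := fun _ => 0 }
  | t + 1, ω =>
      ((S.memory act t ω).refresh (S.cache t ω) (S.cache (t + 1) ω)).record
        (act (t + 1) ω) (S.gain (t + 1) ω (act (t + 1) ω))

/-- The actions `act 1, act 2, …` are those of the adapted UCB policy (ties and the order in which new
actions are played are resolved arbitrarily). -/
def FollowsUCB [Fintype Power] [DecidableEq File] [DecidableEq Power] (S : BaseStation File Power Ω)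
    (β ζ : ℝ) (act : ℕ → Ω → File × Power) : Prop :=
  ∀ t ω, ((S.memory act t ω).refresh (S.cache t ω) (S.cache (t + 1) ω)).Selects β ζ t
    (S.actions (t + 1) ω) (act (t + 1) ω)

end BaseStation

/-- Largest value of `x` on the finite set `I` (and `0` if `I` is empty). -/
def bestValue (I : Finset (File × Power)) (x : File × Power → ℝ) : ℝ :=
  if h : I.Nonempty then I.sup' h x else 0

namespace BaseStation

/-- The stochastic bandit model. The history before round `t + 1` is `ℱ t`; it contains the caches up to
round `t + 1` and the utilities up to round `t`. Utilities are at most `b`. Given the history, action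
`i` has expected utility `mean t i` in round `t`, which does not vary as long as the cache stays the
same, and suboptimal actions of the current action set are suboptimal by at least `Δ`. -/
structure IsBandit [Fintype Power] [mΩ : MeasurableSpace Ω] (S : BaseStation File Power Ω) (P : Measure Ω)
    (ℱ : Filtration ℕ mΩ) (b Δ : ℝ) (mean : ℕ → Ω → File × Power → ℝ) : Prop where
  measurable_cache : ∀ t f, MeasurableSet[ℱ t] {ω | f ∈ S.cache (t + 1) ω}
  measurable_gain : ∀ t i, Measurable[ℱ (t + 1)] (fun ω => S.gain (t + 1) ω i)
  gain_le : ∀ t ω i, S.gain (t + 1) ω i ≤ b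
  condExp_gain : ∀ t i,
    P[fun ω => S.gain (t + 1) ω i | ℱ t] =ᵐ[P] fun ω => mean (t + 1) ω i
  mean_const : ∀ᵐ ω ∂P, ∀ t, 1 ≤ t → S.cache (t + 1) ω = S.cache t ω →
    ∀ i ∈ S.actions t ω, mean (t + 1) ω i = mean t ω i
  gap : ∀ᵐ ω ∂P, ∀ t, 1 ≤ t → ∀ i ∈ S.actions t ω,
    mean t ω i = bestValue (S.actions t ω) (mean t ω) ∨
      mean t ω i + Δ ≤ bestValue (S.actions t ω) (mean t ω)

/-- Expected accumulated regret over the rounds `1, …, θ`: the expected utility of the best available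
action minus the utility obtained, summed over the rounds, in expectation. -/
def expectedRegret [Fintype Power] [MeasurableSpace Ω] (S : BaseStation File Power Ω) (P : Measure Ω)
    (mean : ℕ → Ω → File × Power → ℝ) (act : ℕ → Ω → File × Power) (θ : ℕ) : ℝ :=
  ∫ ω, ∑ t ∈ Finset.Icc 1 θ,
    (bestValue (S.actions t ω) (mean t ω) - S.gain t ω (act t ω)) ∂P

end BaseStation

end

end FemtoCache

end

/-! The regret is a pseudo-regret, which compares conditional means, minus a sum of centred rewards
sampled at predictable times, which has mean zero. A round adds at most `b` to the pseudo-regret,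
and only if a suboptimal action is played. By the usual UCB comparison of indices, either that
action then has play count at most `K`, with `K` of order `log θ`, or some confidence interval fails
(`FollowsUCB.count_le_or_mem_deviationUnion`); the first two rounds are charged separately.

Small counts: a cache change can reset counts, so each action is played with count at most `K` at
most `K + 1` times per change, up to one extra term (`sum_small_count_le`). A change without a new
file shrinks the cache, so the cache size is a potential that bounds the changes by a multiple of
the number of rounds with new files (`changeCount_add_card_le`).

Failures: since the last change, an average consists of at most one carried-over value in `[0, b]`,
about whose law nothing is needed, and fresh samples with constant conditional mean
(`exists_prior_eq`). The carried value shifts the sum by at most `b`, which the deviation events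
absorb. For a fixed start and a fixed sample size, an exponential supermartingale gives probability
of order `t⁻³`. A union over all starts and sizes, needed since both are random, leaves order `1 /
t`, and this sums to order `log θ`. -/

noncomputable section

namespace FemtoCache

/-! ### Concentration of rewards sampled at predictable times -/

section Concentration

/-- Hoeffding's bound on the moment generating function of a Bernoulli variable. -/
theorem one_sub_add_mul_exp_le {p : ℝ} (hp0 : 0 ≤ p) (hp1 : p ≤ 1) (h : ℝ) :
    1 - p + p * Real.exp h ≤ Real.exp (p * h + h ^ 2 / 8) := by
  set ν : Measure ℝ :=
    ENNReal.ofReal (1 - p) • Measure.dirac 0 + ENNReal.ofReal p • Measure.dirac 1 with hν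
  have hprob : IsProbabilityMeasure ν := ⟨by
    simp [hν, ← ENNReal.ofReal_add (sub_nonneg.2 hp1) hp0]⟩
  have hint (f : ℝ → ℝ) : ∫ x, f x ∂ν = (1 - p) * f 0 + p * f 1 := by
    rw [hν, integral_add_measure, integral_smul_measure, integral_smul_measure, integral_dirac,
      integral_dirac, ENNReal.toReal_ofReal (sub_nonneg.2 hp1), ENNReal.toReal_ofReal hp0]
    · simp
    · exact (integrable_dirac (by simp)).smul_measure ENNReal.ofReal_ne_top
    · exact (integrable_dirac (by simp)).smul_measure ENNReal.ofReal_ne_top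
  have hmem : ∀ᵐ x ∂ν, (id x : ℝ) ∈ Set.Icc (0 : ℝ) 1 := by
    rw [hν, ae_add_measure_iff]
    constructor <;> refine Measure.ae_smul_measure ?_ _ <;> simp [ae_dirac_eq]
  have key := (ProbabilityTheory.hasSubgaussianMGF_of_mem_Icc (μ := ν) (X := id)
    aemeasurable_id hmem).mgf_le h
  have hmean : ∫ x, id x ∂ν = p := by rw [hint]; simp
  rw [hmean, ProbabilityTheory.mgf, hint] at key
  have e : 1 - p + p * Real.exp h =
      Real.exp (p * h) * ((1 - p) * Real.exp (h * (id 0 - p)) + p * Real.exp (h * (id 1 - p))) := by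
    rw [mul_add, mul_left_comm, mul_left_comm _ p, ← Real.exp_add, ← Real.exp_add]
    simp only [id]
    ring_nf
    simp only [Real.exp_zero]
    ring
  rw [e, Real.exp_add]
  refine mul_le_mul_of_nonneg_left (key.trans (Real.exp_le_exp.2 ?_)) (Real.exp_pos _).le
  simp
  nlinarith

variable {Ω : Type*} {mΩ : MeasurableSpace Ω} {P : Measure Ω}

theorem integrable_of_abs_le [IsFiniteMeasure P] {f : Ω → ℝ} (hf : Measurable f) {c : ℝ} (hc : ∀ ω, |f ω| ≤ c) :
    Integrable f P :=
  Integrable.of_bound hf.aestronglyMeasurable c (ae_of_all _ hc)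

/-- The pull-out property in integrated form. It suffices for the moment bound because the
exponential is first replaced by a function affine in the reward. -/
theorem integral_mul_eq_of_condExp_ae_eq [IsFiniteMeasure P] {m : MeasurableSpace Ω} (hm : m ≤ mΩ) {X Y μ : Ω → ℝ}
    (hX : Integrable X P) (hY : Measurable[m] Y) {c : ℝ} (hc : ∀ ω, |Y ω| ≤ c)
    (hμ : P[X | m] =ᵐ[P] μ) : ∫ ω, Y ω * X ω ∂P = ∫ ω, Y ω * μ ω ∂P := by
  have h := condExp_mul_of_stronglyMeasurable_left (μ := P) (m := m) hY.stronglyMeasurable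
    (hX.bdd_mul (hY.mono hm le_rfl).aestronglyMeasurable (ae_of_all _ hc)) hX
  rw [show ∫ ω, Y ω * X ω ∂P = ∫ ω, (P[Y * X | m]) ω ∂P from (integral_condExp hm).symm]
  refine integral_congr_ae ?_
  filter_upwards [h, hμ] with ω h1 h2
  rw [h1, Pi.mul_apply, h2]

/-- Number of times `s` with `τ ≤ s < t` at which `A s` occurs. -/
def visits (A : ℕ → Set Ω) (τ t : ℕ) (ω : Ω) : ℕ :=
  ∑ s ∈ Finset.Ico τ t, (A s).indicator (fun _ => 1) ω

/-- Accumulated centred reward over the times `s` with `τ ≤ s < t` at which `A s` occurs. -/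
def deviation (A : ℕ → Set Ω) (X μ : ℕ → Ω → ℝ) (τ t : ℕ) (ω : Ω) : ℝ :=
  ∑ s ∈ Finset.Ico τ t, (A s).indicator (fun ω => X s ω - μ s ω) ω

/-- The samples collected during `[τ, t)`, of which there are `n`, deviate from their means by an
amount comparable to the width of the confidence interval. -/
def deviationEvent (b : ℝ) (A : ℕ → Set Ω) (X μ : ℕ → Ω → ℝ) (τ t n : ℕ) : Set Ω :=
  {ω | visits A τ t ω = n ∧ b * (Real.sqrt (2 * n * Real.log t) - 1) ≤ |deviation A X μ τ t ω|}

/-- Rewards `X s` in `[0, b]`, revealed at time `s + 1`, with conditional mean `μ s` given the history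
at time `s`, which are collected at the times at which the predictable event `A s` occurs. -/
structure IsSampling (P : Measure Ω) (ℱ : Filtration ℕ mΩ) (b : ℝ) (A : ℕ → Set Ω)
    (X μ : ℕ → Ω → ℝ) : Prop where
  measurableSet : ∀ s, MeasurableSet[ℱ s] (A s)
  measurable_reward : ∀ s, Measurable[ℱ (s + 1)] (X s)
  reward_mem : ∀ s ω, X s ω ∈ Set.Icc 0 b
  measurable_mean : ∀ s, Measurable[ℱ s] (μ s)
  mean_mem : ∀ s ω, μ s ω ∈ Set.Icc 0 b
  condExp_reward : ∀ s, P[X s | ℱ s] =ᵐ[P] μ s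

namespace IsSampling

variable {ℱ : Filtration ℕ mΩ} {b : ℝ} {A : ℕ → Set Ω} {X μ : ℕ → Ω → ℝ}

theorem measurable_visits (h : IsSampling P ℱ b A X μ) (τ t : ℕ) : Measurable (visits A τ t) := by
  unfold visits
  exact Finset.measurable_sum _ fun s _ =>
    measurable_const.indicator (ℱ.le s _ (h.measurableSet s))

theorem measurable_deviation (h : IsSampling P ℱ b A X μ) (τ t : ℕ) :
    Measurable (deviation A X μ τ t) := by
  unfold deviation
  exact Finset.measurable_sum _ fun s _ =>
    (((h.measurable_reward s).mono (ℱ.le _) le_rfl).sub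
      ((h.measurable_mean s).mono (ℱ.le _) le_rfl)).indicator (ℱ.le s _ (h.measurableSet s))

theorem measurableSet_deviationEvent (h : IsSampling P ℱ b A X μ) (τ t n : ℕ) :
    MeasurableSet (deviationEvent b A X μ τ t n) :=
  (h.measurable_visits τ t (measurableSet_singleton n)).inter
    (measurableSet_le measurable_const (h.measurable_deviation τ t).abs)

variable [IsProbabilityMeasure P]

/-- A supermartingale argument: each sampled reward multiplies the exponential by a factor of
conditional mean at most one, by Hoeffding's lemma. Measurability and boundedness are carried
through the induction to make all integrals finite. -/
theorem integral_exp_deviation_le_one (h : IsSampling P ℱ b A X μ) (hb : 0 < b) (l : ℝ)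
    {τ t : ℕ} (hτ : τ ≤ t) :
    Measurable[ℱ t] (fun ω =>
      Real.exp (l * deviation A X μ τ t ω - l ^ 2 * b ^ 2 / 8 * visits A τ t ω)) ∧
    (∃ c, ∀ ω, Real.exp (l * deviation A X μ τ t ω - l ^ 2 * b ^ 2 / 8 * visits A τ t ω) ≤ c) ∧
    ∫ ω, Real.exp (l * deviation A X μ τ t ω - l ^ 2 * b ^ 2 / 8 * visits A τ t ω) ∂P ≤ 1 := by
  induction t, hτ using Nat.le_induction with
  | base => simpa [deviation, visits, measurable_const] using ⟨1, fun _ => le_rfl⟩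
  | succ t hτ ih =>
    obtain ⟨hmeas, ⟨c, hc⟩, hint⟩ := ih
    set Z : Ω → ℝ := fun ω =>
      Real.exp (l * deviation A X μ τ t ω - l ^ 2 * b ^ 2 / 8 * visits A τ t ω) with hZ
    have hZ0 : ∀ ω, 0 ≤ Z ω := fun ω => (Real.exp_pos _).le
    have hc0 : ∀ ω : Ω, 0 ≤ c := fun ω => (hZ0 ω).trans (hc ω)
    set W : Ω → ℝ := fun ω =>
      Real.exp ((A t).indicator (fun ω => l * (X t ω - μ t ω) - l ^ 2 * b ^ 2 / 8) ω) with hW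
    have hstep : (fun ω => Real.exp (l * deviation A X μ τ (t + 1) ω -
        l ^ 2 * b ^ 2 / 8 * visits A τ (t + 1) ω)) = fun ω => Z ω * W ω := by
      ext ω
      simp only [hZ, hW, deviation, visits, Finset.sum_Ico_succ_top hτ]
      rw [← Real.exp_add]
      congr 1
      by_cases hω : ω ∈ A t
      · simp only [Set.indicator_of_mem hω]; push_cast; ring
      · simp only [Set.indicator_of_notMem hω]; push_cast; ring
    have hA' : MeasurableSet[ℱ (t + 1)] (A t) := ℱ.mono (Nat.le_succ t) _ (h.measurableSet t)
    have hWmeas : Measurable[ℱ (t + 1)] W := by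
      refine Real.measurable_exp.comp (Measurable.indicator ?_ hA')
      exact (((h.measurable_reward t).sub ((h.measurable_mean t).mono
        (ℱ.mono (Nat.le_succ t)) le_rfl)).const_mul l).sub_const _
    have hWle : ∀ ω, W ω ≤ Real.exp (|l| * b) := fun ω => by
      refine Real.exp_le_exp.2 ?_
      by_cases hω : ω ∈ A t
      · simp only [Set.indicator_of_mem hω]
        have h1 : |X t ω - μ t ω| ≤ b := by
          have := h.reward_mem t ω; have := h.mean_mem t ω
          simp only [Set.mem_Icc] at *
          rw [abs_le]; constructor <;> linarith
        have h2 : l * (X t ω - μ t ω) ≤ |l| * b :=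
          (le_abs_self _).trans (by rw [abs_mul]; gcongr)
        have : 0 ≤ l ^ 2 * b ^ 2 / 8 := by positivity
        linarith
      · simp only [Set.indicator_of_notMem hω]; positivity
    have hmeas' : Measurable[ℱ (t + 1)] (fun ω => Z ω * W ω) :=
      (hmeas.mono (ℱ.mono (Nat.le_succ t)) le_rfl).mul hWmeas
    have hbd : ∀ ω, Z ω * W ω ≤ c * Real.exp (|l| * b) := fun ω =>
      mul_le_mul (hc ω) (hWle ω) (Real.exp_pos _).le (hc0 ω)
    have hrw := fun ω => congrFun hstep ω
    rw [hstep]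
    refine ⟨hmeas', ⟨c * Real.exp (|l| * b), fun ω => (hrw ω).trans_le (hbd ω)⟩, ?_⟩
    -- On `A t` the new factor `W` is `D` times `exp (l * X t)`, and `D` is known at time `t`.
    set D : Ω → ℝ := fun ω => Real.exp (-(l * μ t ω) - l ^ 2 * b ^ 2 / 8) with hD
    have hDmeas : Measurable[ℱ t] D :=
      Real.measurable_exp.comp (((h.measurable_mean t).const_mul l).neg.sub_const _)
    have hDle : ∀ ω, D ω ≤ Real.exp (|l| * b) := fun ω => by
      refine Real.exp_le_exp.2 ?_
      have h1 : |μ t ω| ≤ b := by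
        have := h.mean_mem t ω
        rw [abs_of_nonneg this.1]; exact this.2
      have h2 : -(l * μ t ω) ≤ |l| * b :=
        (neg_le_abs _).trans (by rw [abs_mul]; gcongr)
      have : 0 ≤ l ^ 2 * b ^ 2 / 8 := by positivity
      linarith
    -- The slope of the chord of `x ↦ exp (l * x)` over `[0, b]`. The chord majorant of `Z * W` is
    -- `Y₀ + Y₁ * X t`, with coefficients known at time `t`.
    set κ : ℝ := (Real.exp (l * b) - 1) / b with hκ
    set Y₁ : Ω → ℝ := fun ω => Z ω * (A t).indicator (fun ω => D ω * κ) ω with hY₁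
    set Y₀ : Ω → ℝ := fun ω => Z ω * ((A t).indicator D ω + (A t)ᶜ.indicator (fun _ => 1) ω)
      with hY₀
    have hY₁meas : Measurable[ℱ t] Y₁ :=
      hmeas.mul ((hDmeas.mul_const _).indicator (h.measurableSet t))
    have hY₀meas : Measurable[ℱ t] Y₀ := hmeas.mul
      ((hDmeas.indicator (h.measurableSet t)).add
        (measurable_const.indicator (h.measurableSet t).compl))
    have hY₁le : ∀ ω, |Y₁ ω| ≤ c * (Real.exp (|l| * b) * |κ|) := fun ω => by
      rw [hY₁, abs_mul, abs_of_nonneg (hZ0 ω)]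
      refine mul_le_mul (hc ω) ?_ (abs_nonneg _) (hc0 ω)
      by_cases hω : ω ∈ A t
      · simp only [Set.indicator_of_mem hω]
        rw [abs_mul, abs_of_nonneg (Real.exp_pos _).le]
        exact mul_le_mul_of_nonneg_right (hDle ω) (abs_nonneg _)
      · simp only [Set.indicator_of_notMem hω, abs_zero]; positivity
    have hY₀le : ∀ ω, |Y₀ ω| ≤ c * (Real.exp (|l| * b) + 1) := fun ω => by
      rw [hY₀, abs_mul, abs_of_nonneg (hZ0 ω)]
      refine mul_le_mul (hc ω) ?_ (abs_nonneg _) (hc0 ω)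
      by_cases hω : ω ∈ A t
      · simp only [Set.indicator_of_mem hω, Set.indicator_of_notMem (Set.notMem_compl_iff.2 hω)]
        rw [add_zero, abs_of_nonneg (Real.exp_pos _).le]
        linarith [hDle ω]
      · simp only [Set.indicator_of_notMem hω, Set.indicator_of_mem (Set.mem_compl hω)]
        rw [zero_add, abs_one]
        linarith [Real.exp_pos (|l| * b)]
    have hXm : Measurable (X t) := (h.measurable_reward t).mono (ℱ.le _) le_rfl
    have hμm : Measurable (μ t) := (h.measurable_mean t).mono (ℱ.le _) le_rfl
    have hXabs : ∀ ω, |X t ω| ≤ b := fun ω => by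
      rw [abs_of_nonneg (h.reward_mem t ω).1]; exact (h.reward_mem t ω).2
    have hμabs : ∀ ω, |μ t ω| ≤ b := fun ω => by
      rw [abs_of_nonneg (h.mean_mem t ω).1]; exact (h.mean_mem t ω).2
    have hXi : Integrable (X t) P := integrable_of_abs_le hXm hXabs
    have hμi : Integrable (μ t) P := integrable_of_abs_le hμm hμabs
    have hY₀i : Integrable Y₀ P := integrable_of_abs_le (hY₀meas.mono (ℱ.le _) le_rfl) hY₀le
    have hY₁m := (hY₁meas.mono (ℱ.le t) le_rfl).aestronglyMeasurable (μ := P)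
    have hYXi : Integrable (fun ω => Y₁ ω * X t ω) P := hXi.bdd_mul hY₁m (ae_of_all _ hY₁le)
    have hYμi : Integrable (fun ω => Y₁ ω * μ t ω) P := hμi.bdd_mul hY₁m (ae_of_all _ hY₁le)
    have hZi : Integrable Z P := integrable_of_abs_le (hmeas.mono (ℱ.le _) le_rfl)
      (fun ω => by rw [abs_of_nonneg (hZ0 ω)]; exact hc ω)
    have hZWi : Integrable (fun ω => Z ω * W ω) P :=
      integrable_of_abs_le (hmeas'.mono (ℱ.le _) le_rfl)
        (fun ω => by rw [abs_of_nonneg (mul_nonneg (hZ0 ω) (Real.exp_pos _).le)]; exact hbd ω)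
    calc ∫ ω, Z ω * W ω ∂P ≤ ∫ ω, (Y₀ ω + Y₁ ω * X t ω) ∂P := by
          refine integral_mono hZWi (hY₀i.add hYXi) fun ω => ?_
          simp only [hY₀, hY₁, hW]
          rw [mul_assoc, ← mul_add]
          refine mul_le_mul_of_nonneg_left ?_ (hZ0 ω)
          by_cases hω : ω ∈ A t
          · simp only [Set.indicator_of_mem hω, Set.indicator_of_notMem (Set.notMem_compl_iff.2 hω)]
            have hx := h.reward_mem t ω
            have e : l * (X t ω - μ t ω) - l ^ 2 * b ^ 2 / 8 =
              l * X t ω + (-(l * μ t ω) - l ^ 2 * b ^ 2 / 8) := by ring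
            have hconv := convexOn_exp.2 (Set.mem_univ 0) (Set.mem_univ (l * b))
              (sub_nonneg.2 ((div_le_one hb).2 hx.2)) (div_nonneg hx.1 hb.le) (by ring)
            rw [e, Real.exp_add, add_zero, mul_assoc, ← mul_one_add, mul_comm]
            refine mul_le_mul_of_nonneg_left ?_ (Real.exp_pos _).le
            simp only [smul_eq_mul, mul_zero, zero_add, Real.exp_zero, mul_one] at hconv
            have e2 : X t ω / b * (l * b) = l * X t ω := by field_simp
            rw [e2] at hconv
            refine hconv.trans (le_of_eq ?_)
            rw [hκ]; field_simp; ring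
          · simp [Set.indicator_of_notMem hω, Set.indicator_of_mem (Set.mem_compl hω)]
      _ = ∫ ω, (Y₀ ω + Y₁ ω * μ t ω) ∂P := by
          rw [integral_add hY₀i hYXi, integral_add hY₀i hYμi,
            integral_mul_eq_of_condExp_ae_eq (ℱ.le t) hXi hY₁meas hY₁le (h.condExp_reward t)]
      _ ≤ ∫ ω, Z ω ∂P := by
          refine integral_mono (hY₀i.add hYμi) hZi fun ω => ?_
          simp only [hY₀, hY₁]
          rw [mul_assoc, ← mul_add]
          refine mul_le_of_le_one_right (hZ0 ω) ?_
          by_cases hω : ω ∈ A t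
          · simp only [Set.indicator_of_mem hω, Set.indicator_of_notMem (Set.notMem_compl_iff.2 hω)]
            have hx := h.mean_mem t ω
            -- The chord evaluated at the mean is the moment generating function at `l * b` of a
            -- Bernoulli variable with parameter `μ t / b`.
            have key := one_sub_add_mul_exp_le (div_nonneg hx.1 hb.le) ((div_le_one hb).2 hx.2)
              (l * b)
            have e : D ω = (Real.exp (μ t ω / b * (l * b) + (l * b) ^ 2 / 8))⁻¹ := by
              simp only [hD]; rw [← Real.exp_neg]; congr 1; field_simp; ring
            have e2 : D ω + 0 + D ω * κ * μ t ω =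
                (1 - μ t ω / b + μ t ω / b * Real.exp (l * b)) * D ω := by
              rw [hκ]; field_simp; ring
            rw [e2, e]
            exact mul_inv_le_one_of_le₀ key (Real.exp_pos _).le
          · simp [Set.indicator_of_notMem hω, Set.indicator_of_mem (Set.mem_compl hω)]
      _ ≤ 1 := hint

/-- Markov's inequality for the supermartingale; fixing the number of visits makes its compensator
deterministic. -/
theorem measureReal_visits_eq_and_le (h : IsSampling P ℱ b A X μ) (hb : 0 < b) (l x : ℝ)
    {τ t : ℕ} (hτ : τ ≤ t) (n : ℕ) :
    P.real {ω | visits A τ t ω = n ∧ x ≤ l * deviation A X μ τ t ω} ≤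
      Real.exp (-x + l ^ 2 * b ^ 2 / 8 * n) := by
  obtain ⟨hmeas, ⟨c, hc⟩, hint⟩ := h.integral_exp_deviation_le_one hb l hτ
  set Z : Ω → ℝ := fun ω =>
    Real.exp (l * deviation A X μ τ t ω - l ^ 2 * b ^ 2 / 8 * visits A τ t ω) with hZ
  have hZi : Integrable Z P := integrable_of_abs_le (hmeas.mono (ℱ.le _) le_rfl)
    (fun ω => by rw [abs_of_nonneg (Real.exp_pos _).le]; exact hc ω)
  have hsub : {ω | visits A τ t ω = n ∧ x ≤ l * deviation A X μ τ t ω} ⊆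
      {ω | Real.exp (x - l ^ 2 * b ^ 2 / 8 * n) ≤ Z ω} := by
    rintro ω ⟨h1, h2⟩
    simp only [hZ, Set.mem_ofPred_eq, Real.exp_le_exp, h1]
    linarith
  have hmarkov := mul_meas_ge_le_integral_of_nonneg (μ := P)
    (ae_of_all _ fun ω => (Real.exp_pos _).le) hZi (Real.exp (x - l ^ 2 * b ^ 2 / 8 * n))
  refine (measureReal_mono hsub).trans ?_
  rw [show -x + l ^ 2 * b ^ 2 / 8 * n = -(x - l ^ 2 * b ^ 2 / 8 * n) by ring, Real.exp_neg,
    ← one_div, le_div_iff₀ (Real.exp_pos _), mul_comm]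
  exact hmarkov.trans hint

/-- A Chernoff bound with slack: without the `- 1` in the threshold the exponent would be `-4 log
t`. The slack leaves room for a carried-over sample and costs one power of `t` and the factor `exp
8`. -/
theorem measureReal_deviationEvent_le (h : IsSampling P ℱ b A X μ) (hb : 0 < b)
    {τ t n : ℕ} (hτ : τ ≤ t) (ht : 1 ≤ t) (hn : 1 ≤ n) :
    P.real (deviationEvent b A X μ τ t n) ≤ 2 * Real.exp 8 / (t : ℝ) ^ 3 := by
  set L : ℝ := Real.log t with hL
  have hL0 : 0 ≤ L := Real.log_nonneg (by exact_mod_cast ht)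
  have hn0 : (0 : ℝ) < n := by exact_mod_cast hn
  have ht0 : (0 : ℝ) < t := by exact_mod_cast ht
  -- With this `r` the threshold is `b * (n * r - 1)`, and `4 * r / b` is the optimal exponential
  -- parameter when the `- 1` is ignored.
  set r : ℝ := Real.sqrt (2 * L / n) with hr
  have hr0 : 0 ≤ r := Real.sqrt_nonneg _
  have hr2 : r ^ 2 = 2 * L / n := Real.sq_sqrt (by positivity)
  have hrn : Real.sqrt (2 * n * L) = n * r := by
    rw [show 2 * n * L = n ^ 2 * (2 * L / n) by field_simp, Real.sqrt_mul (by positivity),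
      Real.sqrt_sq hn0.le]
  set x : ℝ := 4 * r * (n * r - 1) with hx
  have hexp : Real.exp (-x + (4 * r / b) ^ 2 * b ^ 2 / 8 * n) ≤ Real.exp 8 / (t : ℝ) ^ 3 := by
    rw [le_div_iff₀ (by positivity)]
    have : (t : ℝ) ^ 3 = Real.exp (3 * L) := by
      rw [mul_comm, Real.exp_mul, hL, Real.exp_log ht0]; norm_cast
    rw [this, ← Real.exp_add, Real.exp_le_exp]
    have e1 : (4 * r / b) ^ 2 * b ^ 2 / 8 * n = 2 * (n * r ^ 2) := by field_simp; ring
    have e2 : n * r ^ 2 = 2 * L := by rw [hr2]; field_simp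
    have e3 : r ^ 2 ≤ 2 * L := by
      rw [hr2]; exact div_le_self (by positivity) (by exact_mod_cast hn)
    rw [e1, hx]
    -- The exponent is now `-4 * L + 4 * r`; from `(r - 4) ^ 2 ≥ 0` and `r ^ 2 ≤ 2 * L` follows `4 *
    -- r ≤ 8 + L`.
    nlinarith [sq_nonneg (r - 4)]
  have hsub : deviationEvent b A X μ τ t n ⊆
      {ω | visits A τ t ω = n ∧ x ≤ (4 * r / b) * deviation A X μ τ t ω} ∪
      {ω | visits A τ t ω = n ∧ x ≤ (-(4 * r / b)) * deviation A X μ τ t ω} := by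
    rintro ω ⟨h1, h2⟩
    rw [← hL, hrn] at h2
    have h3 : x ≤ (4 * r / b) * |deviation A X μ τ t ω| := by
      calc x = (4 * r / b) * (b * (n * r - 1)) := by rw [hx]; field_simp
        _ ≤ _ := by gcongr
    rcases abs_choice (deviation A X μ τ t ω) with h4 | h4
    · exact Or.inl ⟨h1, h4 ▸ h3⟩
    · refine Or.inr ⟨h1, ?_⟩
      rw [h4] at h3
      linarith
  refine (measureReal_mono hsub).trans ((measureReal_union_le _ _).trans ?_)
  have h1 := h.measureReal_visits_eq_and_le hb (4 * r / b) x hτ n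
  have h2 := h.measureReal_visits_eq_and_le hb (-(4 * r / b)) x hτ n
  rw [neg_sq] at h2
  calc _ ≤ Real.exp 8 / (t : ℝ) ^ 3 + Real.exp 8 / (t : ℝ) ^ 3 :=
        add_le_add (h1.trans hexp) (h2.trans hexp)
    _ = _ := by ring

end IsSampling

/-- Some deviation event occurs at time `t`. -/
def deviationUnion (b : ℝ) (A : ℕ → Set Ω) (X μ : ℕ → Ω → ℝ) (t : ℕ) : Set Ω :=
  ⋃ τ ∈ Finset.range t, ⋃ n ∈ Finset.Icc 1 t, deviationEvent b A X μ τ t n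

namespace IsSampling

variable {ℱ : Filtration ℕ mΩ} {b : ℝ} {A : ℕ → Set Ω} {X μ : ℕ → Ω → ℝ}

theorem measurableSet_deviationUnion (h : IsSampling P ℱ b A X μ) (t : ℕ) :
    MeasurableSet (deviationUnion b A X μ t) :=
  Finset.measurableSet_biUnion _ fun τ _ => Finset.measurableSet_biUnion _ fun n _ =>
    h.measurableSet_deviationEvent τ t n

/-- There are `t` starts and `t` sample sizes, each pair costing order `t⁻³`. -/
theorem measureReal_deviationUnion_le [IsProbabilityMeasure P] (h : IsSampling P ℱ b A X μ) (hb : 0 < b) (t : ℕ) :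
    P.real (deviationUnion b A X μ t) ≤ 2 * Real.exp 8 * (t : ℝ)⁻¹ := by
  rcases Nat.eq_zero_or_pos t with rfl | ht
  · simp [deviationUnion]
  have ht0 : (0 : ℝ) < t := by exact_mod_cast ht
  calc P.real (deviationUnion b A X μ t)
      ≤ ∑ τ ∈ Finset.range t, ∑ n ∈ Finset.Icc 1 t, P.real (deviationEvent b A X μ τ t n) :=
        (measureReal_biUnion_finset_le _ _).trans
          (Finset.sum_le_sum fun τ _ => measureReal_biUnion_finset_le _ _)
    _ ≤ ∑ τ ∈ Finset.range t, ∑ n ∈ Finset.Icc 1 t, 2 * Real.exp 8 / (t : ℝ) ^ 3 :=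
        Finset.sum_le_sum fun τ hτ => Finset.sum_le_sum fun n hn =>
          h.measureReal_deviationEvent_le hb (Finset.mem_range.1 hτ).le ht (Finset.mem_Icc.1 hn).1
    _ = 2 * Real.exp 8 * (t : ℝ)⁻¹ := by
        simp only [Finset.sum_const, Finset.card_range, Nat.card_Icc, nsmul_eq_mul,
          Nat.add_sub_cancel]
        field_simp

end IsSampling

end Concentration

theorem utility_nonneg (p : ℝ) (hp : 0 < p) (D q : ℕ) (a : ℕ → ℕ) : 0 ≤ utility p D q a := by
  unfold utility energy
  positivity

theorem bestValue_le {File Power : Type*} {I : Finset (File × Power)} {x : File × Power → ℝ} {b : ℝ}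
    (hb : 0 ≤ b) (h : ∀ i, x i ≤ b) : bestValue I x ≤ b := by
  unfold bestValue
  split_ifs with hI
  · exact Finset.sup'_le hI x fun i _ => h i
  · exact hb

theorem exists_mem_eq_bestValue {File Power : Type*} {I : Finset (File × Power)} (hI : I.Nonempty)
    (x : File × Power → ℝ) : ∃ i ∈ I, bestValue I x = x i := by
  rw [bestValue, dif_pos hI]
  exact Finset.exists_mem_eq_sup' hI x

theorem le_bestValue {File Power : Type*} {I : Finset (File × Power)} {x : File × Power → ℝ}
    {i : File × Power} (hi : i ∈ I) : x i ≤ bestValue I x := by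
  rw [bestValue, dif_pos ⟨i, hi⟩]
  exact Finset.le_sup' x hi

/-! ### Deterministic analysis along one sample path -/

section Pathwise

variable {File Power Ω : Type*}

namespace BaseStation

theorem gain_nonneg (S : BaseStation File Power Ω) (t : ℕ) (ω : Ω) (i : File × Power) :
    0 ≤ S.gain t ω i :=
  utility_nonneg _ (S.level_pos _) _ _ _

variable [DecidableEq File]

/-- Number of rounds among `1, …, θ` in which the cache differs from that of the previous round. -/
def changeCount (S : BaseStation File Power Ω) (θ : ℕ) (ω : Ω) : ℕ :=
  ∑ t ∈ Finset.range θ, if S.cache t ω = S.cache (t + 1) ω then 0 else 1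

theorem newFileCount_eq_sum (S : BaseStation File Power Ω) (θ : ℕ) (ω : Ω) :
    S.newFileCount θ ω =
      ∑ t ∈ Finset.range θ, if (S.cache (t + 1) ω \ S.cache t ω).Nonempty then 1 else 0 := by
  rw [newFileCount, Finset.card_filter, Finset.range_eq_Ico,
    ← Finset.Ico_add_one_right_eq_Icc, ← zero_add 1,
    ← Finset.sum_Ico_add' _ 0 θ 1]
  simp only [Nat.add_sub_cancel]

/-- The cache size serves as a potential: a round with a new file raises the left side by at most
`|File| + 1`, and any other change removes a file, which pays for the change. -/
theorem changeCount_add_card_le [Fintype File] (S : BaseStation File Power Ω) (θ : ℕ) (ω : Ω) :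
    S.changeCount θ ω + (S.cache θ ω).card ≤ (Fintype.card File + 1) * S.newFileCount θ ω := by
  rw [newFileCount_eq_sum, changeCount]
  induction θ with
  | zero => simp [S.cache_zero]
  | succ θ ih =>
    rw [Finset.sum_range_succ, Finset.sum_range_succ, mul_add]
    by_cases h : (S.cache (θ + 1) ω \ S.cache θ ω).Nonempty
    · have h1 := Finset.card_le_univ (S.cache (θ + 1) ω)
      rw [if_pos h]
      split_ifs <;> omega
    · rw [if_neg h]
      rw [Finset.not_nonempty_iff_eq_empty, Finset.sdiff_eq_empty_iff_subset] at h
      by_cases he : S.cache θ ω = S.cache (θ + 1) ω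
      · rw [if_pos he, ← he]; omega
      · have := Finset.card_lt_card (lt_of_le_of_ne h (Ne.symm he))
        rw [if_neg he]; omega

theorem newFileCount_pos (S : BaseStation File Power Ω) {θ : ℕ} (hθ : 1 ≤ θ) (ω : Ω) :
    1 ≤ S.newFileCount θ ω := by
  rw [newFileCount, Nat.one_le_iff_ne_zero, ← Nat.pos_iff_ne_zero, Finset.card_pos]
  refine ⟨1, Finset.mem_filter.2 ⟨Finset.mem_Icc.2 ⟨le_rfl, hθ⟩, ?_⟩⟩
  simpa [S.cache_zero] using S.cache_nonempty 0 ω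

variable [DecidableEq Power]

/-- The memory at the beginning of round `t + 1`, after the adaptation to the cache. -/
def prior (S : BaseStation File Power Ω) (act : ℕ → Ω → File × Power) (t : ℕ) (ω : Ω) :
    Memory File Power :=
  (S.memory act t ω).refresh (S.cache t ω) (S.cache (t + 1) ω)

variable (S : BaseStation File Power Ω) (act : ℕ → Ω → File × Power)

theorem count_memory_succ (t : ℕ) (ω : Ω) (i : File × Power) :
    (S.memory act (t + 1) ω).count i =
      (S.prior act t ω).count i + if act (t + 1) ω = i then 1 else 0 := by
  simp only [memory, Memory.record, prior, Function.update_apply]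
  by_cases h : i = act (t + 1) ω
  · subst h; simp
  · simp [h, Ne.symm h]

theorem avg_memory_succ (t : ℕ) (ω : Ω) (i : File × Power) :
    (S.memory act (t + 1) ω).avg i = if act (t + 1) ω = i then
      (((S.prior act t ω).count i : ℝ) * (S.prior act t ω).avg i + S.gain (t + 1) ω i) /
        (((S.prior act t ω).count i : ℝ) + 1) else (S.prior act t ω).avg i := by
  simp only [memory, Memory.record, prior, Function.update_apply]
  by_cases h : i = act (t + 1) ω
  · subst h; simp
  · simp [h, Ne.symm h]

theorem prior_of_cache_eq {t : ℕ} {ω : Ω} (h : S.cache t ω = S.cache (t + 1) ω) :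
    S.prior act t ω = S.memory act t ω := by
  rw [prior, Memory.refresh, if_pos h]

theorem count_prior_le_one {t : ℕ} {ω : Ω} (h : S.cache t ω ≠ S.cache (t + 1) ω)
    (i : File × Power) : (S.prior act t ω).count i ≤ 1 := by
  rw [prior, Memory.refresh, if_neg h]
  dsimp only
  split_ifs <;> omega

theorem avg_prior_mem_of_memory {b : ℝ} (hb : 0 ≤ b) {t : ℕ} {ω : Ω} {i : File × Power}
    (h : (S.memory act t ω).avg i ∈ Set.Icc 0 b) : (S.prior act t ω).avg i ∈ Set.Icc 0 b := by
  rw [prior, Memory.refresh]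
  split_ifs
  · exact h
  · dsimp only
    split_ifs
    · exact h
    · exact ⟨le_rfl, hb⟩

theorem avg_memory_mem {b : ℝ} (hb : 0 ≤ b) {ω : Ω} (hg : ∀ t i, S.gain (t + 1) ω i ≤ b) (t : ℕ)
    (i : File × Power) : (S.memory act t ω).avg i ∈ Set.Icc 0 b := by
  induction t with
  | zero => exact ⟨le_rfl, hb⟩
  | succ t ih =>
    have h := S.avg_prior_mem_of_memory act hb ih
    rw [avg_memory_succ]
    split_ifs
    · have hx0 := S.gain_nonneg (t + 1) ω i
      have hx1 := hg t i
      set k : ℝ := ((S.prior act t ω).count i : ℝ)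
      have hk : 0 ≤ k := Nat.cast_nonneg _
      refine ⟨div_nonneg (add_nonneg (mul_nonneg hk h.1) hx0) (by positivity), ?_⟩
      rw [div_le_iff₀ (by positivity)]
      nlinarith [mul_le_mul_of_nonneg_left h.2 hk]
    · exact h

/-- The event that action `i` is played in round `s + 1`. -/
def playSet (act : ℕ → Ω → File × Power) (i : File × Power) (s : ℕ) : Set Ω :=
  {ω | act (s + 1) ω = i}

/-- Since the last change of the cache, the memory of an action is that of ordinary UCB started from
at most one sample with some value in `[0, b]`. -/
theorem exists_prior_eq {b : ℝ} (hb : 0 ≤ b) {ω : Ω} (hg : ∀ t i, S.gain (t + 1) ω i ≤ b) (t : ℕ)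
    (i : File × Power) :
    ∃ τ ≤ t, (∀ s, τ ≤ s → s ≤ t → S.cache (s + 1) ω = S.cache (t + 1) ω) ∧
      ∃ v : ℕ, v ≤ 1 ∧ ∃ x ∈ Set.Icc 0 b,
        (S.prior act t ω).count i = v + visits (playSet act i) τ t ω ∧
        ((S.prior act t ω).count i : ℝ) * (S.prior act t ω).avg i = v * x +
          ∑ s ∈ Finset.Ico τ t,
            (playSet act i s).indicator (fun ω => S.gain (s + 1) ω i) ω := by
  -- A memory of count at most one is itself the carried-over sample, with `τ = t` and no fresh
  -- samples.
  have restart (t : ℕ) (h : (S.prior act t ω).count i ≤ 1) :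
      ∃ τ ≤ t, (∀ s, τ ≤ s → s ≤ t → S.cache (s + 1) ω = S.cache (t + 1) ω) ∧
      ∃ v : ℕ, v ≤ 1 ∧ ∃ x ∈ Set.Icc 0 b,
        (S.prior act t ω).count i = v + visits (playSet act i) τ t ω ∧
        ((S.prior act t ω).count i : ℝ) * (S.prior act t ω).avg i = v * x +
          ∑ s ∈ Finset.Ico τ t,
            (playSet act i s).indicator (fun ω => S.gain (s + 1) ω i) ω := by
    refine ⟨t, le_rfl, fun s h1 h2 => by rw [le_antisymm h2 h1], _, h,
      (S.prior act t ω).avg i,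
      S.avg_prior_mem_of_memory act hb (S.avg_memory_mem act hb hg t i), ?_, ?_⟩
    · simp [visits]
    · simp
  induction t with
  | zero =>
    refine restart 0 ?_
    by_cases h : S.cache 0 ω = S.cache 1 ω
    · rw [S.prior_of_cache_eq act h]; exact Nat.zero_le 1
    · exact S.count_prior_le_one act h i
  | succ t ih =>
    by_cases h : S.cache (t + 1) ω = S.cache (t + 1 + 1) ω
    · obtain ⟨τ, hτ, hcache, v, hv, x, hx, hcount, hsum⟩ := ih
      refine ⟨τ, hτ.trans (Nat.le_succ t), fun s h1 h2 => ?_, v, hv, x, hx, ?_, ?_⟩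
      · rcases Nat.le_succ_iff.1 h2 with h3 | rfl
        · rw [hcache s h1 h3, h]
        · rfl
      · rw [S.prior_of_cache_eq act h, count_memory_succ, hcount, visits, visits,
          Finset.sum_Ico_succ_top hτ, add_assoc]
        simp [playSet, Set.indicator_apply]
      · rw [S.prior_of_cache_eq act h, count_memory_succ, avg_memory_succ,
          Finset.sum_Ico_succ_top hτ, ← add_assoc, ← hsum]
        by_cases ha : act (t + 1) ω = i
        · have : ω ∈ playSet act i t := ha
          rw [if_pos ha, if_pos ha, Set.indicator_of_mem this]
          have : ((S.prior act t ω).count i : ℝ) + 1 ≠ 0 := by positivity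
          push_cast
          field_simp
        · have : ω ∉ playSet act i t := ha
          rw [if_neg ha, if_neg ha, Set.indicator_of_notMem this]
          simp
    · exact restart (t + 1) (S.count_prior_le_one act h i)

/-- The truncated count `min count (K + 1)` is a potential: each counted play raises it by one, and
a cache change destroys at most `K + 1` of it. -/
theorem sum_small_count_le (K θ : ℕ) (ω : Ω) (i : File × Power) :
    (∑ t ∈ Finset.range θ,
        if act (t + 1) ω = i ∧ (S.prior act t ω).count i ≤ K then 1 else 0) ≤
      (K + 1) * S.changeCount θ ω + min ((S.memory act θ ω).count i) (K + 1) := by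
  induction θ with
  | zero => simp
  | succ θ ih =>
    rw [Finset.sum_range_succ, changeCount, Finset.sum_range_succ, ← changeCount,
      count_memory_succ, mul_add]
    have hstep : (if act (θ + 1) ω = i ∧ (S.prior act θ ω).count i ≤ K then 1 else 0) +
        min ((S.prior act θ ω).count i) (K + 1) ≤
        min ((S.prior act θ ω).count i + if act (θ + 1) ω = i then 1 else 0) (K + 1) := by
      by_cases ha : act (θ + 1) ω = i
      · by_cases hk : (S.prior act θ ω).count i ≤ K
        · rw [if_pos ⟨ha, hk⟩, if_pos ha]; omega
        · rw [if_neg fun h => hk h.2, if_pos ha]; omega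
      · rw [if_neg fun h => ha h.1, if_neg ha]; omega
    by_cases h : S.cache θ ω = S.cache (θ + 1) ω
    · rw [if_pos h]
      rw [S.prior_of_cache_eq act h] at hstep ⊢
      omega
    · rw [if_neg h]
      omega

/-- If the average reward of an action is off by more than the width of its confidence interval, then
one of the deviation events of this action occurs. -/
theorem mem_deviationUnion {b β ζ : ℝ} (hb : 0 < b) (hβ : 0 < β) (hζ : 2 * b ^ 2 ≤ β ^ 2 * ζ) {ω : Ω}
    (hg : ∀ t i, S.gain (t + 1) ω i ≤ b) {t : ℕ} (ht : 2 ≤ t) {i : File × Power}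
    {μ : ℕ → Ω → ℝ}
    (hμ : ∀ s ≤ t,
      (∀ r, s ≤ r → r ≤ t → S.cache (r + 1) ω = S.cache (t + 1) ω) → μ s ω = μ t ω)
    (hμ0 : μ t ω ∈ Set.Icc 0 b) (hcount : (S.prior act t ω).count i ≠ 0)
    (hdev : β * Real.sqrt (ζ * Real.log t / (S.prior act t ω).count i) <
      |(S.prior act t ω).avg i - μ t ω|) :
    ω ∈ deviationUnion b (playSet act i) (fun s ω => S.gain (s + 1) ω i) μ t := by
  obtain ⟨τ, hτ, hcache, v, hv, x, hx, hc, hsum⟩ := S.exists_prior_eq act hb.le hg t i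
  set V : ℕ := (S.prior act t ω).count i with hV
  set n := visits (playSet act i) τ t ω with hn
  set M := deviation (playSet act i) (fun s ω => S.gain (s + 1) ω i) μ τ t ω with hM
  have hV0 : (0 : ℝ) < V := by exact_mod_cast Nat.pos_of_ne_zero hcount
  have ht1 : (1 : ℝ) < t := by exact_mod_cast ht
  have hL : 0 < Real.log t := Real.log_pos ht1
  have hζ0 : 0 < ζ := by
    by_contra hneg
    have : β ^ 2 * ζ ≤ 0 := mul_nonpos_of_nonneg_of_nonpos (sq_nonneg _) (not_lt.1 hneg)
    have : 0 < b ^ 2 := by positivity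
    linarith
  -- The cache is constant from `τ` on, so all fresh samples are centred at the same value `μ t ω`.
  have hMeq : M = (∑ s ∈ Finset.Ico τ t,
      (playSet act i s).indicator (fun ω => S.gain (s + 1) ω i) ω) - n * μ t ω := by
    rw [hM, hn, deviation, visits, Nat.cast_sum, Finset.sum_mul, ← Finset.sum_sub_distrib]
    refine Finset.sum_congr rfl fun s hs => ?_
    rw [Finset.mem_Ico] at hs
    have e := hμ s hs.2.le fun r h1 h2 => hcache r (hs.1.trans h1) h2
    by_cases h : ω ∈ playSet act i s
    · simp [Set.indicator_of_mem h, e]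
    · simp [Set.indicator_of_notMem h]
  have hVc : (V : ℝ) = v + n := by exact_mod_cast hc
  have hdecomp : V * ((S.prior act t ω).avg i - μ t ω) = v * (x - μ t ω) + M := by
    rw [mul_sub, hsum, hMeq, hVc]; ring
  have hvx : |(v : ℝ) * (x - μ t ω)| ≤ b := by
    have h1 : |x - μ t ω| ≤ b := abs_le.2 ⟨by linarith [hx.1, hμ0.2], by linarith [hx.2, hμ0.1]⟩
    rw [abs_mul, Nat.abs_cast]
    have h2 : (v : ℝ) ≤ 1 := by exact_mod_cast hv
    calc (v : ℝ) * |x - μ t ω| ≤ 1 * b := by gcongr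
      _ = b := one_mul b
  have hwidth : ∀ k : ℝ, k ≤ V → b * Real.sqrt (2 * k * Real.log t) ≤
      V * (β * Real.sqrt (ζ * Real.log t / V)) := fun k hk => by
    have e1 : V * (β * Real.sqrt (ζ * Real.log t / V)) =
        Real.sqrt (β ^ 2 * ζ * (V * Real.log t)) := by
      rw [show β ^ 2 * ζ * (V * Real.log t) = (V * β) ^ 2 * (ζ * Real.log t / V) by field_simp,
        Real.sqrt_mul (by positivity), Real.sqrt_sq (by positivity), mul_assoc]
    have e2 : b * Real.sqrt (2 * k * Real.log t) = Real.sqrt (2 * b ^ 2 * (k * Real.log t)) := by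
      rw [show 2 * b ^ 2 * (k * Real.log t) = b ^ 2 * (2 * k * Real.log t) by ring,
        Real.sqrt_mul (sq_nonneg b) (2 * k * Real.log t), Real.sqrt_sq hb.le]
    rw [e1, e2]
    refine Real.sqrt_le_sqrt ?_
    have h1 : k * Real.log t ≤ V * Real.log t := by gcongr
    calc 2 * b ^ 2 * (k * Real.log t) ≤ 2 * b ^ 2 * (V * Real.log t) := by gcongr
      _ ≤ _ := by gcongr
  have hmain : V * (β * Real.sqrt (ζ * Real.log t / V)) < b + |M| := by
    calc _ < V * |(S.prior act t ω).avg i - μ t ω| := by gcongr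
      _ = |(v : ℝ) * (x - μ t ω) + M| := by rw [← hdecomp, abs_mul, Nat.abs_cast]
      _ ≤ _ := (abs_add_le _ _).trans (by gcongr)
  -- Without fresh samples the error is at most `b`, while the scaled width is at least `b` because
  -- `2 * log 2 ≥ 1`; this uses `2 ≤ t`.
  have hn1 : 1 ≤ n := by
    by_contra h0
    have h0 : n = 0 := by omega
    have hM0 : M = 0 := by
      have hz : ∀ s ∈ Finset.Ico τ t, ω ∉ playSet act i s := fun s hs hmem => by
        have := (Finset.sum_eq_zero_iff.1 (hn.symm.trans h0)) s hs
        simp [Set.indicator_of_mem hmem] at this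
      rw [hM, deviation]
      exact Finset.sum_eq_zero fun s hs => Set.indicator_of_notMem (hz s hs) _
    have h2 := hwidth 1 (by exact_mod_cast Nat.pos_of_ne_zero hcount)
    rw [hM0, abs_zero, add_zero] at hmain
    have h3 : 1 ≤ Real.sqrt (2 * 1 * Real.log t) := by
      rw [Real.one_le_sqrt]
      have : Real.log 2 ≤ Real.log t := Real.log_le_log two_pos (by exact_mod_cast ht)
      linarith [Real.log_two_gt_d9]
    have h4 := mul_le_mul_of_nonneg_left h3 hb.le
    rw [mul_one] at h4
    exact (h4.trans h2).not_gt hmain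
  have hnt : n ≤ t - τ := by
    calc n ≤ ∑ s ∈ Finset.Ico τ t, 1 :=
          Finset.sum_le_sum fun s _ => Set.indicator_le_self' (fun _ _ => Nat.zero_le 1) ω
      _ = t - τ := by simp
  simp only [deviationUnion, Set.mem_iUnion]
  refine ⟨τ, Finset.mem_range.2 (by omega), n, Finset.mem_Icc.2 ⟨hn1, by omega⟩, rfl, ?_⟩
  have h2 := hwidth n (by rw [hVc]; linarith [Nat.cast_nonneg (α := ℝ) v])
  rw [mul_sub, mul_one]
  change _ ≤ |M|
  linarith

variable [Fintype Power]

theorem sum_sum_small_count_le [Fintype File] (K : ℕ) {θ : ℕ} (ω : Ω) :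
    ∑ t ∈ Finset.range θ, ∑ i : File × Power,
      (if act (t + 1) ω = i ∧ (S.prior act t ω).count i ≤ K then (1 : ℝ) else 0) ≤
    Fintype.card (File × Power) *
      ((K + 1) * ((Fintype.card File + 1) * S.newFileCount θ ω + 1)) := by
  rw [Finset.sum_comm, ← nsmul_eq_mul, ← Finset.card_univ]
  refine Finset.sum_le_card_nsmul _ _ _ fun i _ => ?_
  have h1 := S.sum_small_count_le act K θ ω i
  have h2 : S.changeCount θ ω ≤ (Fintype.card File + 1) * S.newFileCount θ ω :=
    (Nat.le_add_right _ _).trans (S.changeCount_add_card_le θ ω)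
  have h3 : (∑ t ∈ Finset.range θ,
      if act (t + 1) ω = i ∧ (S.prior act t ω).count i ≤ K then 1 else 0) ≤
      (K + 1) * ((Fintype.card File + 1) * S.newFileCount θ ω + 1) := by
    calc _ ≤ (K + 1) * S.changeCount θ ω + (K + 1) := h1.trans (by gcongr; exact min_le_right _ _)
      _ = (K + 1) * (S.changeCount θ ω + 1) := by ring
      _ ≤ _ := by gcongr
  exact_mod_cast h3

variable {S act} {b Δ β ζ : ℝ}

/-- A suboptimal play in round `t + 1` is explained by a small play count or a large deviation. -/
theorem FollowsUCB.count_le_or_mem_deviationUnion (hucb : S.FollowsUCB β ζ act) (hb : 0 < b)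
    (hΔ : 0 < Δ) (hβ : 0 < β) (hζ : 2 * b ^ 2 ≤ β ^ 2 * ζ) {μ : File × Power → ℕ → Ω → ℝ} {ω : Ω}
    (hμ : ∀ i s, μ i s ω ∈ Set.Icc 0 b) (hg : ∀ t i, S.gain (t + 1) ω i ≤ b)
    (hconst : ∀ s, S.cache (s + 1 + 1) ω = S.cache (s + 1) ω → ∀ i ∈ S.actions (s + 1) ω,
      μ i (s + 1) ω = μ i s ω)
    {t : ℕ} (ht : 2 ≤ t)
    (hgap : μ (act (t + 1) ω) t ω + Δ ≤ bestValue (S.actions (t + 1) ω) fun i => μ i t ω)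
    {K : ℕ} (hK : 4 * (β ^ 2 * ζ) / Δ ^ 2 * Real.log t < K + 1) :
    (S.prior act t ω).count (act (t + 1) ω) ≤ K ∨
      ∃ j, ω ∈ deviationUnion b (playSet act j) (fun s ω => S.gain (s + 1) ω j) (μ j) t := by
  have hcst : ∀ j ∈ S.actions (t + 1) ω, ∀ s ≤ t,
      (∀ r, s ≤ r → r ≤ t → S.cache (r + 1) ω = S.cache (t + 1) ω) → μ j s ω = μ j t ω := by
    intro j hj s hs hr
    obtain ⟨k, rfl⟩ := Nat.exists_eq_add_of_le hs
    have hk : ∀ m ≤ k, μ j (s + m) ω = μ j s ω := by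
      intro m hm
      induction m with
      | zero => rfl
      | succ m ih =>
        have e1 := hr (s + m) (by omega) (by omega)
        have e2 := hr (s + (m + 1)) (by omega) (by omega)
        rw [← ih (by omega)]
        refine hconst (s + m) (e2.trans e1.symm) j ?_
        rw [actions, e1]
        exact hj
    exact (hk k le_rfl).symm
  by_contra hcon
  push Not at hcon
  obtain ⟨hcount, hdev⟩ := hcon
  obtain ⟨hmem, hnew, hmax⟩ := hucb t ω
  rw [← prior] at hnew hmax
  -- If some action were new, the played one would be new too, but its count exceeds `K`.
  have hne : ∀ j ∈ S.actions (t + 1) ω, (S.prior act t ω).count j ≠ 0 := fun j hj h0 => by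
    have := hnew ⟨j, hj, h0⟩
    omega
  have hconf : ∀ j ∈ S.actions (t + 1) ω, |(S.prior act t ω).avg j - μ j t ω| ≤
      β * Real.sqrt (ζ * Real.log t / (S.prior act t ω).count j) := fun j hj => by
    by_contra hlt
    exact hdev j (S.mem_deviationUnion act hb hβ hζ hg ht (hcst j hj) (hμ j t) (hne j hj)
      (not_le.1 hlt))
  obtain ⟨j, hj, hbest⟩ := exists_mem_eq_bestValue ⟨_, hmem⟩ fun i => μ i t ω
  rw [hbest] at hgap
  have h1 := hmax hne j hj
  simp only [Memory.index] at h1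
  have h2 := abs_le.1 (hconf j hj)
  have h3 := abs_le.1 (hconf _ hmem)
  set V : ℕ := (S.prior act t ω).count (act (t + 1) ω) with hV
  have hV0 : (0 : ℝ) < V := by exact_mod_cast (by omega : 0 < V)
  -- The best mean is at most its own index, hence at most the index of the played action, which
  -- exceeds that action's mean by at most two widths.
  have hw : Δ ≤ 2 * (β * Real.sqrt (ζ * Real.log t / V)) := by linarith [h2.1, h3.2]
  have hL : 0 ≤ Real.log t := Real.log_nonneg (by exact_mod_cast (by omega : 1 ≤ t))
  have hζ0 : 0 ≤ ζ := by
    by_contra hneg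
    have : β ^ 2 * ζ ≤ 0 :=
      mul_nonpos_of_nonneg_of_nonpos (sq_nonneg _) (not_le.1 hneg).le
    have : 0 < b ^ 2 := by positivity
    linarith
  have hsq : Δ ^ 2 ≤ 4 * (β ^ 2 * ζ) * Real.log t / V := by
    calc Δ ^ 2 ≤ (2 * (β * Real.sqrt (ζ * Real.log t / V))) ^ 2 := by gcongr
      _ = 4 * β ^ 2 * Real.sqrt (ζ * Real.log t / V) ^ 2 := by ring
      _ = 4 * β ^ 2 * (ζ * Real.log t / V) := by rw [Real.sq_sqrt (by positivity)]
      _ = _ := by ring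
  have hVle : (V : ℝ) ≤ 4 * (β ^ 2 * ζ) / Δ ^ 2 * Real.log t := by
    rw [le_div_iff₀ hV0] at hsq
    rw [div_mul_eq_mul_div, le_div_iff₀ (by positivity)]
    linarith
  have : (V : ℝ) < K + 1 := hVle.trans_lt hK
  have : V < K + 1 := by exact_mod_cast this
  omega

end BaseStation

end Pathwise

/-! ### Zero-mean noise, measurability of the best value, and the harmonic sum -/

theorem IsSampling.integrable_deviation_and_integral_eq_zero {Ω : Type*} {mΩ : MeasurableSpace Ω}
    {P : Measure Ω} [IsProbabilityMeasure P] {ℱ : Filtration ℕ mΩ} {b : ℝ} {A : ℕ → Set Ω}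
    {X μ : ℕ → Ω → ℝ} (h : IsSampling P ℱ b A X μ) (τ t : ℕ) :
    Integrable (deviation A X μ τ t) P ∧ ∫ ω, deviation A X μ τ t ω ∂P = 0 := by
  have hXi : ∀ s, Integrable (X s) P := fun s =>
    integrable_of_abs_le ((h.measurable_reward s).mono (ℱ.le _) le_rfl) (c := b) fun ω => by
      rw [abs_of_nonneg (h.reward_mem s ω).1]; exact (h.reward_mem s ω).2
  have hμi : ∀ s, Integrable (μ s) P := fun s =>
    integrable_of_abs_le ((h.measurable_mean s).mono (ℱ.le _) le_rfl) (c := b) fun ω => by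
      rw [abs_of_nonneg (h.mean_mem s ω).1]; exact (h.mean_mem s ω).2
  have hi : ∀ s, Integrable ((A s).indicator (fun ω => X s ω - μ s ω)) P := fun s =>
    ((hXi s).sub (hμi s)).indicator (ℱ.le s _ (h.measurableSet s))
  refine ⟨integrable_finsetSum _ fun s _ => hi s, ?_⟩
  simp only [deviation]
  rw [integral_finsetSum _ fun s _ => hi s]
  refine Finset.sum_eq_zero fun s _ => ?_
  have hA := ℱ.le s _ (h.measurableSet s)
  rw [integral_indicator hA, integral_sub (hXi s).integrableOn (hμi s).integrableOn,
    ← setIntegral_condExp (ℱ.le s) (hXi s) (h.measurableSet s), sub_eq_zero]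
  exact integral_congr_ae (ae_restrict_of_ae (h.condExp_reward s))

/-- The random set takes finitely many values, and on each of them the best value is a finite
maximum or zero. -/
theorem measurable_bestValue {File Power Ω : Type*} [MeasurableSpace Ω] [Fintype File]
    [DecidableEq File] [Fintype Power] [DecidableEq Power] {I : Ω → Finset (File × Power)}
    {x : Ω → File × Power → ℝ} (hI : ∀ i, MeasurableSet {ω | i ∈ I ω})
    (hx : ∀ i, Measurable fun ω => x ω i) : Measurable fun ω => bestValue (I ω) (x ω) := by
  have hset : ∀ J : Finset (File × Power), MeasurableSet {ω | I ω = J} := fun J => by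
    have : {ω | I ω = J} = ⋂ i, if i ∈ J then {ω | i ∈ I ω} else {ω | i ∈ I ω}ᶜ := by
      ext ω
      simp only [Set.mem_ofPred_eq, Set.mem_iInter, Finset.ext_iff]
      refine forall_congr' fun i => ?_
      split_ifs with h <;> simp [h]
    rw [this]
    refine MeasurableSet.iInter fun i => ?_
    split_ifs
    · exact hI i
    · exact (hI i).compl
  have hfix : ∀ J : Finset (File × Power), Measurable fun ω => bestValue J (x ω) := fun J => by
    unfold bestValue
    split_ifs with hJ
    · have := Finset.measurable_sup' hJ (f := fun i ω => x ω i) fun i _ => hx i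
      convert this using 1
      ext ω
      rw [Finset.sup'_apply]
    · exact measurable_const
  have hsum : (fun ω => bestValue (I ω) (x ω)) = fun ω =>
      ∑ J : Finset (File × Power), {ω | I ω = J}.indicator (fun ω => bestValue J (x ω)) ω := by
    ext ω
    rw [Finset.sum_eq_single (I ω)]
    · simp
    · intro J _ hJ
      simp [Ne.symm hJ]
    · simp
  rw [hsum]
  exact Finset.measurable_sum _ fun J _ => (hfix J).indicator (hset J)

theorem sum_range_inv_le_one_add_log (n : ℕ) :
    ∑ t ∈ Finset.range n, (t : ℝ)⁻¹ ≤ 1 + Real.log n := by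
  have h := harmonic_le_one_add_log n
  rw [harmonic] at h
  push_cast at h
  have e := Finset.sum_range_succ' (fun t : ℕ => (t : ℝ)⁻¹) n
  rw [Finset.sum_range_succ] at e
  push_cast at e
  have : (0 : ℝ) ≤ (n : ℝ)⁻¹ := by positivity
  simp only [inv_zero, add_zero] at e
  linarith

/-! ### Regret in the bandit model -/

namespace BaseStation

variable {File Power Ω : Type*} [mΩ : MeasurableSpace Ω]

/-- The conditional expectation of the utility of action `i` in round `s + 1` given the history of the
first `s` rounds, in a version with values in `[0, b]`. -/
def predictedGain (S : BaseStation File Power Ω) (P : Measure Ω) (ℱ : Filtration ℕ mΩ) (b : ℝ)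
    (i : File × Power) (s : ℕ) (ω : Ω) : ℝ :=
  max 0 (min b ((P[fun ω => S.gain (s + 1) ω i | ℱ s]) ω))

variable {P : Measure Ω} {ℱ : Filtration ℕ mΩ}
  {S : BaseStation File Power Ω} {mean : ℕ → Ω → File × Power → ℝ} {act : ℕ → Ω → File × Power}
  {b Δ β ζ : ℝ}

namespace IsBandit

variable [Fintype Power]

theorem measurable_newFileCount [Fintype File] [DecidableEq File] (h : S.IsBandit P ℱ b Δ mean) (θ : ℕ) :
    Measurable fun ω => (S.newFileCount θ ω : ℝ) := by
  have hcache : ∀ t f, MeasurableSet {ω | f ∈ S.cache t ω} := fun t f => by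
    cases t with
    | zero => simp [S.cache_zero]
    | succ t => exact ℱ.le t _ (h.measurable_cache t f)
  simp only [newFileCount_eq_sum]
  push_cast
  refine Finset.measurable_sum _ fun t _ => Measurable.ite ?_ measurable_const measurable_const
  have : {ω | (S.cache (t + 1) ω \ S.cache t ω).Nonempty} =
      ⋃ f, {ω | f ∈ S.cache (t + 1) ω} \ {ω | f ∈ S.cache t ω} := by
    ext ω
    simp [Finset.Nonempty]
  rw [this]
  exact MeasurableSet.iUnion fun f => (hcache _ f).diff (hcache _ f)

variable [IsProbabilityMeasure P]

theorem integrable_gain (h : S.IsBandit P ℱ b Δ mean) (s : ℕ) (i : File × Power) :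
    Integrable (fun ω => S.gain (s + 1) ω i) P :=
  integrable_of_abs_le ((h.measurable_gain s i).mono (ℱ.le _) le_rfl) (c := b) fun ω => by
    rw [abs_of_nonneg (S.gain_nonneg _ ω i)]; exact h.gain_le s ω i

theorem condExp_gain_ae_eq (h : S.IsBandit P ℱ b Δ mean) (s : ℕ) (i : File × Power) :
    P[fun ω => S.gain (s + 1) ω i | ℱ s] =ᵐ[P] S.predictedGain P ℱ b i s := by
  have h0 : 0 ≤ᵐ[P] P[fun ω => S.gain (s + 1) ω i | ℱ s] :=
    condExp_nonneg (ae_of_all _ fun ω => S.gain_nonneg _ ω i)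
  have h1 : P[fun ω => S.gain (s + 1) ω i | ℱ s] ≤ᵐ[P] P[fun _ => b | ℱ s] :=
    condExp_mono (h.integrable_gain s i) (integrable_const b) (ae_of_all _ fun ω => h.gain_le s ω i)
  rw [condExp_const (ℱ.le s)] at h1
  filter_upwards [h0, h1] with ω hω0 hω1
  rw [predictedGain, min_eq_right hω1]
  exact (max_eq_right hω0).symm

theorem mean_ae_eq [Finite File] (h : S.IsBandit P ℱ b Δ mean) :
    ∀ᵐ ω ∂P, ∀ s i, mean (s + 1) ω i = S.predictedGain P ℱ b i s ω := by
  rw [ae_all_iff]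
  intro s
  rw [ae_all_iff]
  intro i
  filter_upwards [h.condExp_gain s i, h.condExp_gain_ae_eq s i] with ω h1 h2
  rw [← h1, h2]

/-- Time `s` precedes round `s + 1`: the action of that round is known at time `s`, its utility at
time `s + 1`. -/
theorem isSampling (h : S.IsBandit P ℱ b Δ mean) (hb : 0 ≤ b)
    (hact : ∀ t i, MeasurableSet[ℱ t] {ω | act (t + 1) ω = i}) (i : File × Power) :
    IsSampling P ℱ b (playSet act i) (fun s ω => S.gain (s + 1) ω i)
      (S.predictedGain P ℱ b i) where
  measurableSet s := hact s i
  measurable_reward s := h.measurable_gain s i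
  reward_mem s ω := ⟨S.gain_nonneg _ ω i, h.gain_le s ω i⟩
  measurable_mean _ :=
    measurable_const.max (measurable_const.min stronglyMeasurable_condExp.measurable)
  mean_mem _ _ := ⟨le_max_left _ _, max_le hb (min_le_left _ _)⟩
  condExp_reward s := h.condExp_gain_ae_eq s i

variable [Fintype File] [DecidableEq File]

theorem integrable_newFileCount (h : S.IsBandit P ℱ b Δ mean) (θ : ℕ) :
    Integrable (fun ω => (S.newFileCount θ ω : ℝ)) P := by
  refine integrable_of_abs_le (h.measurable_newFileCount θ) (c := θ) fun ω => ?_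
  rw [Nat.abs_cast, newFileCount]
  exact_mod_cast (Finset.card_filter_le _ _).trans (by simp)

end IsBandit

variable [IsProbabilityMeasure P]
  [Fintype File] [DecidableEq File] [Fintype Power] [DecidableEq Power]

/-- Regret of round `t + 1` relative to the expected utilities. -/
def pseudoRegret (S : BaseStation File Power Ω) (mean : ℕ → Ω → File × Power → ℝ)
    (act : ℕ → Ω → File × Power) (t : ℕ) (ω : Ω) : ℝ :=
  bestValue (S.actions (t + 1) ω) (mean (t + 1) ω) - mean (t + 1) ω (act (t + 1) ω)

theorem FollowsUCB.sum_pseudoRegret_le (hucb : S.FollowsUCB β ζ act)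
    (hS : S.IsBandit P ℱ b Δ mean) (hb : 0 < b) (hΔ : 0 < Δ) (hβ : 0 < β)
    (hζ : 2 * b ^ 2 ≤ β ^ 2 * ζ) {K θ : ℕ}
    (hK : 4 * (β ^ 2 * ζ) / Δ ^ 2 * Real.log θ < K + 1) :
    ∀ᵐ ω ∂P, ∑ t ∈ Finset.range θ, S.pseudoRegret mean act t ω ≤
      b * (Fintype.card (File × Power) *
        ((K + 1) * ((Fintype.card File + 1) * S.newFileCount θ ω + 1)) + 2 +
        ∑ t ∈ Finset.range θ, ∑ i : File × Power,
          (deviationUnion b (playSet act i) (fun s ω => S.gain (s + 1) ω i)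
            (S.predictedGain P ℱ b i) t).indicator (fun _ => 1) ω) := by
  filter_upwards [hS.mean_ae_eq, hS.mean_const, hS.gap] with ω hmean hconst hgap
  have hmem : ∀ i s, S.predictedGain P ℱ b i s ω ∈ Set.Icc 0 b := fun i s =>
    ⟨le_max_left _ _, max_le hb.le (min_le_left _ _)⟩
  have hround : ∀ t ∈ Finset.range θ, S.pseudoRegret mean act t ω ≤
      b * ((∑ i : File × Power,
        (if act (t + 1) ω = i ∧ (S.prior act t ω).count i ≤ K then (1 : ℝ) else 0)) +
        (if t ≤ 1 then 1 else 0) +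
        ∑ i : File × Power,
          (deviationUnion b (playSet act i) (fun s ω => S.gain (s + 1) ω i)
            (S.predictedGain P ℱ b i) t).indicator (fun _ => 1) ω) := by
    intro t ht
    have n1 : ∀ i : File × Power, 0 ≤
        (if act (t + 1) ω = i ∧ (S.prior act t ω).count i ≤ K then (1 : ℝ) else 0) :=
      fun i => by split_ifs <;> norm_num
    have n2 : (0 : ℝ) ≤ if t ≤ 1 then 1 else 0 := by split_ifs <;> norm_num
    have n3 : ∀ i : File × Power, 0 ≤
        (deviationUnion b (playSet act i) (fun s ω => S.gain (s + 1) ω i)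
            (S.predictedGain P ℱ b i) t).indicator (fun _ => (1 : ℝ)) ω :=
      fun i => Set.indicator_nonneg (fun _ _ => zero_le_one) ω
    have s1 := Finset.sum_nonneg fun i (_ : i ∈ Finset.univ) => n1 i
    have s3 := Finset.sum_nonneg fun i (_ : i ∈ Finset.univ) => n3 i
    have hact := (hucb t ω).1
    rcases hgap (t + 1) (by omega) _ hact with heq | hlt
    · rw [pseudoRegret, heq, sub_self]
      positivity
    have hle : S.pseudoRegret mean act t ω ≤ b := by
      have h1 := bestValue_le (I := S.actions (t + 1) ω) (x := mean (t + 1) ω) hb.le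
        fun i => by rw [hmean]; exact (hmem i t).2
      have h2 : 0 ≤ mean (t + 1) ω (act (t + 1) ω) := by rw [hmean]; exact (hmem _ t).1
      rw [pseudoRegret]
      linarith
    refine hle.trans (le_mul_of_one_le_right hb.le ?_)
    by_cases ht1 : t ≤ 1
    · rw [if_pos ht1]; linarith
    have hgap' : S.predictedGain P ℱ b (act (t + 1) ω) t ω + Δ ≤
        bestValue (S.actions (t + 1) ω) fun i => S.predictedGain P ℱ b i t ω := by
      rw [← hmean, ← funext fun i => hmean t i]
      exact hlt
    have hconst' : ∀ s, S.cache (s + 1 + 1) ω = S.cache (s + 1) ω → ∀ i ∈ S.actions (s + 1) ω,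
        S.predictedGain P ℱ b i (s + 1) ω = S.predictedGain P ℱ b i s ω := fun s hs i hi => by
      rw [← hmean, ← hmean]
      exact hconst (s + 1) (by omega) hs i hi
    have hζ0 : 0 ≤ β ^ 2 * ζ := le_trans (by positivity) hζ
    have hlog : Real.log t ≤ Real.log θ :=
      Real.log_le_log (by exact_mod_cast (by omega : 0 < t))
        (by exact_mod_cast (Finset.mem_range.1 ht).le)
    have hK' : 4 * (β ^ 2 * ζ) / Δ ^ 2 * Real.log t < K + 1 :=
      (mul_le_mul_of_nonneg_left hlog (by positivity)).trans_lt hK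
    rcases hucb.count_le_or_mem_deviationUnion hb hΔ hβ hζ hmem (fun t i => hS.gain_le t ω i)
      hconst' (by omega) hgap' hK' with hsmall | ⟨j, hj⟩
    · have := Finset.single_le_sum (fun i _ => n1 i) (Finset.mem_univ (act (t + 1) ω))
      rw [if_pos ⟨rfl, hsmall⟩] at this
      linarith
    · have := Finset.single_le_sum (fun i _ => n3 i) (Finset.mem_univ j)
      rw [Set.indicator_of_mem hj] at this
      linarith
  -- Indices `0` and `1` are charged in full, since the confidence argument requires `2 ≤ t`.
  have htwo : ∑ t ∈ Finset.range θ, (if t ≤ 1 then (1 : ℝ) else 0) ≤ 2 := by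
    rw [← Finset.sum_filter, Finset.sum_const, nsmul_eq_mul, mul_one]
    have : (Finset.range θ).filter (· ≤ 1) ⊆ Finset.range 2 := fun t ht => by
      rw [Finset.mem_filter] at ht
      exact Finset.mem_range.2 (by omega)
    have := Finset.card_le_card this
    rw [Finset.card_range] at this
    exact_mod_cast this
  refine (Finset.sum_le_sum hround).trans ?_
  rw [← Finset.mul_sum, Finset.sum_add_distrib, Finset.sum_add_distrib]
  have := S.sum_sum_small_count_le act K (θ := θ) ω
  gcongr

theorem FollowsUCB.expectedRegret_le_of_count (hucb : S.FollowsUCB β ζ act)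
    (hS : S.IsBandit P ℱ b Δ mean)
    (hact : ∀ t i, MeasurableSet[ℱ t] {ω | act (t + 1) ω = i})
    (hb : 0 < b) (hΔ : 0 < Δ) (hβ : 0 < β)
    (hζ : 2 * b ^ 2 ≤ β ^ 2 * ζ) {K θ : ℕ}
    (hK : 4 * (β ^ 2 * ζ) / Δ ^ 2 * Real.log θ < K + 1) :
    S.expectedRegret P mean act θ ≤
      b * (Fintype.card (File × Power) *
        ((K + 1) * ((Fintype.card File + 1) * (∫ ω, (S.newFileCount θ ω : ℝ) ∂P) + 1)) + 2 +
        Fintype.card (File × Power) * (2 * Real.exp 8 * (1 + Real.log θ))) := by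
  have hsam := fun i => hS.isSampling hb.le hact i
  set N : ℕ := Fintype.card (File × Power)
  set U : File × Power → ℕ → Set Ω := fun i t =>
    deviationUnion b (playSet act i) (fun s ω => S.gain (s + 1) ω i) (S.predictedGain P ℱ b i) t
    with hU
  have hUm : ∀ i t, MeasurableSet (U i t) := fun i t => (hsam i).measurableSet_deviationUnion t
  set R : Ω → ℝ := fun ω => ∑ t ∈ Finset.range θ, S.pseudoRegret mean act t ω with hR
  set G : Ω → ℝ := fun ω => b * (N *
        ((K + 1) * ((Fintype.card File + 1) * S.newFileCount θ ω + 1)) + 2 +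
        ∑ t ∈ Finset.range θ, ∑ i : File × Power, (U i t).indicator (fun _ => 1) ω) with hG
  set M : Ω → ℝ := fun ω => ∑ i : File × Power,
    deviation (playSet act i) (fun s ω => S.gain (s + 1) ω i) (S.predictedGain P ℱ b i) 0 θ ω with hM
  have hRG : R ≤ᵐ[P] G := hucb.sum_pseudoRegret_le hS hb hΔ hβ hζ hK
  have hR0 : ∀ ω, 0 ≤ R ω := fun ω => Finset.sum_nonneg fun t _ =>
    sub_nonneg.2 (le_bestValue (hucb t ω).1)
  have hind : ∀ i t, Integrable ((U i t).indicator fun _ => (1 : ℝ)) P := fun i t =>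
    (integrable_const 1).indicator (hUm i t)
  have hBi := hS.integrable_newFileCount θ
  have hI1 : Integrable (fun ω => N *
      ((K + 1) * ((Fintype.card File + 1) * (S.newFileCount θ ω : ℝ) + 1)) + 2) P :=
    ((((hBi.const_mul _).add (integrable_const 1)).const_mul _).const_mul _).add
      (integrable_const 2)
  have hI2 : Integrable (fun ω => ∑ t ∈ Finset.range θ, ∑ i : File × Power,
      (U i t).indicator (fun _ => (1 : ℝ)) ω) P :=
    integrable_finsetSum _ fun t _ => integrable_finsetSum _ fun i _ => hind i t
  have hGi : Integrable G P := (hI1.add hI2).const_mul b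
  -- `mean` need not be measurable, so a measurable version is built from `predictedGain`, with the
  -- played action resolved by indicators.
  have hRm : AEStronglyMeasurable R P := by
    have hpm : ∀ i s, Measurable (S.predictedGain P ℱ b i s) := fun i s =>
      ((hsam i).measurable_mean s).mono (ℱ.le _) le_rfl
    have hm : Measurable fun ω => ∑ t ∈ Finset.range θ,
        (bestValue (S.actions (t + 1) ω) (fun i => S.predictedGain P ℱ b i t ω) -
          ∑ i : File × Power, (playSet act i t).indicator (S.predictedGain P ℱ b i t) ω) := by
      refine Finset.measurable_sum _ fun t _ => Measurable.sub ?_ ?_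
      · refine measurable_bestValue (fun i => ?_) fun i => hpm i t
        have : {ω | i ∈ S.actions (t + 1) ω} = {ω | i.1 ∈ S.cache (t + 1) ω} := by
          ext ω; simp [actions]
        rw [this]
        exact ℱ.le t _ (hS.measurable_cache t i.1)
      · exact Finset.measurable_sum _ fun i _ => (hpm i t).indicator (ℱ.le t _ (hact t i))
    refine hm.aestronglyMeasurable.congr ?_
    filter_upwards [hS.mean_ae_eq] with ω hω
    refine Finset.sum_congr rfl fun t _ => ?_
    simp only [pseudoRegret, playSet, Set.indicator_apply, Set.mem_ofPred_eq, Finset.sum_ite_eq,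
      Finset.mem_univ, if_true]
    rw [hω, funext fun i => hω t i]
  have hRi : Integrable R P := hGi.mono' hRm (by
    filter_upwards [hRG] with ω hω
    rw [Real.norm_of_nonneg (hR0 ω)]
    exact hω)
  have hMi : Integrable M P := integrable_finsetSum _ fun i _ =>
    ((hsam i).integrable_deviation_and_integral_eq_zero 0 θ).1
  have hM0 : ∫ ω, M ω ∂P = 0 := by
    rw [hM, integral_finsetSum _ fun i _ =>
      ((hsam i).integrable_deviation_and_integral_eq_zero 0 θ).1]
    exact Finset.sum_eq_zero fun i _ => ((hsam i).integrable_deviation_and_integral_eq_zero 0 θ).2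
  -- In each round exactly one action contributes to `M`, namely the played one, with its utility
  -- minus its conditional mean.
  have hsplit : S.expectedRegret P mean act θ = ∫ ω, (R ω - M ω) ∂P := by
    refine integral_congr_ae ?_
    filter_upwards [hS.mean_ae_eq] with ω hω
    simp only [hR, hM, deviation]
    rw [Finset.sum_comm, ← Finset.range_eq_Ico, ← Finset.sum_sub_distrib,
      ← Finset.Ico_add_one_right_eq_Icc, Finset.range_eq_Ico]
    nth_rw 1 [← zero_add 1]
    rw [← Finset.sum_Ico_add' _ 0 θ 1]
    refine Finset.sum_congr rfl fun t _ => ?_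
    simp only [pseudoRegret, playSet, Set.indicator_apply, Set.mem_ofPred_eq, Finset.sum_ite_eq,
      Finset.mem_univ, if_true]
    rw [hω]
    ring
  have hGint : ∫ ω, G ω ∂P = b * (N *
      ((K + 1) * ((Fintype.card File + 1) * (∫ ω, (S.newFileCount θ ω : ℝ) ∂P) + 1)) + 2 +
      ∑ t ∈ Finset.range θ, ∑ i : File × Power, P.real (U i t)) := by
    simp only [hG]
    rw [integral_const_mul, integral_add hI1 hI2, integral_add _ (integrable_const 2),
      integral_const_mul, integral_const_mul, integral_add _ (integrable_const 1),
      integral_const_mul, integral_finsetSum _ fun t _ => integrable_finsetSum _ fun i _ => hind i t]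
    · simp only [integral_finsetSum _ fun i _ => hind i _, integral_indicator (hUm _ _)]
      simp
    · exact hBi.const_mul _
    · exact (((hBi.const_mul _).add (integrable_const 1)).const_mul _).const_mul _
  have hprob : ∑ t ∈ Finset.range θ, ∑ i : File × Power, P.real (U i t) ≤
      N * (2 * Real.exp 8 * (1 + Real.log θ)) := by
    calc _ ≤ ∑ t ∈ Finset.range θ, ∑ i : File × Power, 2 * Real.exp 8 * (t : ℝ)⁻¹ :=
          Finset.sum_le_sum fun t _ => Finset.sum_le_sum fun i _ =>
            (hsam i).measureReal_deviationUnion_le hb t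
      _ = N * (2 * Real.exp 8 * ∑ t ∈ Finset.range θ, (t : ℝ)⁻¹) := by
          simp only [Finset.sum_const, Finset.card_univ, nsmul_eq_mul, ← Finset.mul_sum]
          rfl
      _ ≤ _ := by gcongr; exact sum_range_inv_le_one_add_log θ
  rw [hsplit, integral_sub hRi hMi, hM0, sub_zero]
  refine (integral_mono_ae hRi hGi hRG).trans ?_
  rw [hGint]
  gcongr

end BaseStation

end FemtoCache

end

theorem proposition2 (File Power : Type*) [Fintype File] [DecidableEq File]
    [Fintype Power] [DecidableEq Power] [Nonempty Power]
    (b Δ β ζ : ℝ) (hb : 0 < b) (hΔ : 0 < Δ) (hβ : 0 < β) (hζ : 2 * b ^ 2 ≤ β ^ 2 * ζ) :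
    ∃ C : ℝ, ∀ (Ω : Type*) [mΩ : MeasurableSpace Ω] (P : Measure Ω) [IsProbabilityMeasure P]
      (ℱ : Filtration ℕ mΩ) (S : FemtoCache.BaseStation File Power Ω)
      (mean : ℕ → Ω → File × Power → ℝ) (act : ℕ → Ω → File × Power),
      S.IsBandit P ℱ b Δ mean →
      (∀ t i, MeasurableSet[ℱ t] {ω | act (t + 1) ω = i}) →
      S.FollowsUCB β ζ act →
      ∀ θ : ℕ, 2 ≤ θ →
        S.expectedRegret P mean act θ ≤
          C * (∫ ω, (S.newFileCount θ ω : ℝ) ∂P) * Real.log (θ : ℝ) := by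
  -- The additive constants are absorbed using `1 ≤ 2 * log θ` and an expected count of at least
  -- one: `2` becomes `4`, `2 * (1 + log θ)` becomes `6 * log θ`, and the threshold `K = ⌊q * l⌋₊`
  -- satisfies `K + 1 ≤ (q + 2) * l`.
  refine ⟨b * (Fintype.card (File × Power) *
    ((4 * (β ^ 2 * ζ) / Δ ^ 2 + 2) * (Fintype.card File + 2)) + 4 +
    Fintype.card (File × Power) * (6 * Real.exp 8)), ?_⟩
  intro Ω mΩ P hP ℱ S mean act hS hact hucb θ hθ
  set q : ℝ := 4 * (β ^ 2 * ζ) / Δ ^ 2 with hq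
  have hζ0 : 0 ≤ β ^ 2 * ζ := le_trans (by positivity) hζ
  have hq0 : 0 ≤ q := by positivity
  set l : ℝ := Real.log θ with hl
  have hl2 : 1 ≤ 2 * l := by
    have : Real.log 2 ≤ l := Real.log_le_log two_pos (by exact_mod_cast hθ)
    linarith [Real.log_two_gt_d9]
  have hl0 : 0 < l := by linarith
  set E : ℝ := ∫ ω, (S.newFileCount θ ω : ℝ) ∂P with hE
  have hE1 : 1 ≤ E := by
    have := integral_mono (μ := P) (integrable_const (1 : ℝ)) (hS.integrable_newFileCount θ)
      fun ω => by
        exact (Nat.one_le_cast (α := ℝ)).2 (S.newFileCount_pos (by omega : 1 ≤ θ) ω)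
    simpa using this
  have hlE : l ≤ l * E := le_mul_of_one_le_right hl0.le hE1
  refine (hucb.expectedRegret_le_of_count hS hact hb hΔ hβ hζ (Nat.lt_floor_add_one (q * l))).trans ?_
  rw [mul_assoc _ E l, mul_assoc b]
  refine mul_le_mul_of_nonneg_left ?_ hb.le
  rw [add_mul _ _ (E * l), add_mul _ _ (E * l), mul_assoc _ _ (E * l)]
  have hK : (⌊q * l⌋₊ : ℝ) + 1 ≤ (q + 2) * l := by
    have := Nat.floor_le (mul_nonneg hq0 hl0.le)
    linarith
  refine add_le_add (add_le_add ?_ ?_) ?_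
  · refine mul_le_mul_of_nonneg_left ?_ (Nat.cast_nonneg (α := ℝ) _)
    have h1 : ((Fintype.card File : ℝ) + 1) * E + 1 ≤ (Fintype.card File + 2) * E := by linarith
    calc _ ≤ ((q + 2) * l) * ((Fintype.card File + 2) * E) := by gcongr
      _ = _ := by ring
  · linarith
  · rw [mul_assoc _ _ (E * l)]
    refine mul_le_mul_of_nonneg_left ?_ (Nat.cast_nonneg (α := ℝ) _)
    have : 2 * (1 + l) ≤ 6 * (E * l) := by linarith
    nlinarith [Real.exp_pos 8]
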